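/- All rings are commutative. A homomorphism of noetherian local rings is called \emph{weakly regular} if it is local and flat and its closed fiber is a regular local ring. A \emph{Cohen factorization} of a local homomorphism $\varphi\colon R\to S$ of noetherian local rings is a factorization $R\to R'\to\widehat S$ of the composite of $\varphi$ with the completion map $S\to\widehat S$ (completion at the maximal ideal of $S$) into local homomorphisms such that $R'$ is a complete noetherian local ring, $R\to R'$ is weakly regular, and $R'\to\widehat S$ is surjective. One says that $\varphi$ has \emph{finite upper c.i. dimension} if there exist a Cohen factorization $R\to R'\to\widehat S$ of $\varphi$ and local homomorphisms of noetherian local rings $R'\xrightarrow{h}R''\xleftarrow{f}Q$ such that $h$ is weakly regular, $f$ is surjective, $\ker f$ is generated by a regular sequence, and $\operatorname{pd}_Q(\widehat S\otimes_{R'}R'')<\infty$. Let $(R,\mathfrak m,k)$ be a noetherian local ring which is a complete intersection, that is, $\widehat R$ is a quotient of a regular local ring by an ideal generated by a regular sequence. Let $I$ be a nonzero proper ideal of $R$ with $I\cap\mathfrak m^2=\mathfrak m I$ which is not generated by a regular sequence. (Regular sequences may be empty, and the ideal they generate is always proper.) Then the $R$-module $R/I$ has infinite projective dimension, and the quotient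 map $\varphi\colon R\to R/I$ has finite upper c.i. dimension. -/

import Mathlib

open IsLocalRing CategoryTheory
open scoped TensorProduct

universe u

/-- The ideal `I` is generated by a (possibly empty) regular sequence. -/
def GeneratedByRegularSequence {R : Type u} [CommRing R] (I : Ideal R) : Prop :=
  ∃ rs : List R, RingTheory.Sequence.IsRegular R rs ∧ Ideal.ofList rs = I

/-- A noetherian local ring is a (local) complete intersection if its completion is a quotient of
a regular local ring by an ideal generated by a regular sequence. -/
def IsLocalCompleteIntersection (R : Type u) [CommRing R] [IsLocalRing R] [IsNoetherianRing R] :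
    Prop :=
  ∃ (Q : Type u) (_ : CommRing Q) (_ : IsRegularLocalRing Q)
    (π : Q →+* AdicCompletion (maximalIdeal R) R),
    Function.Surjective π ∧ GeneratedByRegularSequence (RingHom.ker π)

/-- A homomorphism of noetherian local rings is weakly regular if it is local and flat and its
closed fiber is a regular local ring. -/
structure WeaklyRegularHom {A B : Type u} [CommRing A] [IsLocalRing A] [IsNoetherianRing A]
    [CommRing B] [IsLocalRing B] [IsNoetherianRing B] (f : A →+* B) : Prop where
  isLocalHom : IsLocalHom f
  flat : f.Flat
  regular_closedFiber : IsRegularLocalRing (B ⧸ (maximalIdeal A).map f)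

/-- `R → R' → Ŝ`, given by `ι` and `φ'`, is a Cohen factorization of the local homomorphism
`φ : R → S` of noetherian local rings; here `Ŝ` is the completion of `S` at its maximal ideal. -/
structure IsCohenFactorization {R S R' : Type u}
    [CommRing R] [IsLocalRing R] [IsNoetherianRing R]
    [CommRing S] [IsLocalRing S] [IsNoetherianRing S]
    [CommRing R'] [IsLocalRing R'] [IsNoetherianRing R'] (φ : R →+* S)
    (ι : R →+* R') (φ' : R' →+* AdicCompletion (maximalIdeal S) S) : Prop where
  comp_eq : φ'.comp ι = (algebraMap S (AdicCompletion (maximalIdeal S) S)).comp φ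
  weaklyRegular : WeaklyRegularHom ι
  complete : IsAdicComplete (maximalIdeal R') R'
  isLocalHom : IsLocalHom φ'
  surjective : Function.Surjective φ'

/-- The diagram `R' → R'' ← Q` of local homomorphisms, given by `h` and `f`, is a
quasi-deformation (with regular closed fiber). -/
structure IsUpperQuasiDeformation {R' R'' Q : Type u}
    [CommRing R'] [IsLocalRing R'] [IsNoetherianRing R']
    [CommRing R''] [IsLocalRing R''] [IsNoetherianRing R'']
    [CommRing Q] [IsLocalRing Q] [IsNoetherianRing Q]
    (h : R' →+* R'') (f : Q →+* R'') : Prop where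
  weaklyRegular : WeaklyRegularHom h
  isLocalHom : IsLocalHom f
  surjective : Function.Surjective f
  ker_ci : GeneratedByRegularSequence (RingHom.ker f)

/-- For ring homomorphisms `a : A → T`, `h : A → B` and `f : Q → B`, the projective dimension of
`T ⊗[A] B` as a `Q`-module is finite, where `Q` acts through `f` and the map `B → T ⊗[A] B`. -/
def FiniteProjDimBaseChange {A T B Q : Type u} [CommRing A] [CommRing T] [CommRing B] [CommRing Q]
    (a : A →+* T) (h : A →+* B) (f : Q →+* B) : Prop :=
  letI : Algebra A T := a.toAlgebra
  letI : Algebra A B := h.toAlgebra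
  letI g : B →+* T ⊗[A] B :=
    (Algebra.TensorProduct.includeRight : B →ₐ[A] T ⊗[A] B).toRingHom
  projectiveDimension
    ((ModuleCat.restrictScalars (g.comp f)).obj (ModuleCat.of (T ⊗[A] B) (T ⊗[A] B))) < ⊤

/-- The homomorphism `φ : R → S` of noetherian local rings has finite upper c.i. dimension. -/
def FiniteUpperCIDim {R S : Type u}
    [CommRing R] [IsLocalRing R] [IsNoetherianRing R]
    [CommRing S] [IsLocalRing S] [IsNoetherianRing S] (φ : R →+* S) : Prop :=
  ∃ (R' : Type u) (_ : CommRing R') (_ : IsLocalRing R') (_ : IsNoetherianRing R')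
    (ι : R →+* R') (φ' : R' →+* AdicCompletion (maximalIdeal S) S)
    (R'' : Type u) (_ : CommRing R'') (_ : IsLocalRing R'') (_ : IsNoetherianRing R'')
    (Q : Type u) (_ : CommRing Q) (_ : IsLocalRing Q) (_ : IsNoetherianRing Q)
    (h : R' →+* R'') (f : Q →+* R''),
    IsCohenFactorization φ ι φ' ∧ IsUpperQuasiDeformation h f ∧ FiniteProjDimBaseChange φ' h f

/-!
Finiteness of the upper c.i. dimension uses only that `R` is a complete intersection and that
`R → R ⧸ I` is surjective. Write `R̂ = Q ⧸ (f)` with `Q` regular local and `f` a regular sequence.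
Then `R → R̂ → (R ⧸ I)^` is a Cohen factorization (its first map is flat, with closed fiber the
residue field), `R̂ = R̂ ← Q` is a quasi-deformation, and every finitely generated `Q`-module has
finite projective dimension (`IsRegularLocalRing.exists_hasProjectiveDimensionLE`).

For the projective dimension of `R ⧸ I`, it is shown over any noetherian local ring `(R, 𝔪)` that a
proper ideal `I` with `I ∩ 𝔪² ⊆ 𝔪 I` and `R ⧸ I` of finite projective dimension is generated by a
regular sequence, by induction on the number of generators of `I`. Suppose `I ≠ 0`.

* `I` lies in no associated prime (`not_le_of_mem_associatedPrimes`). Localized at an associated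
  prime, a module of finite projective dimension is free, and its rank does not depend on the prime
  (`rankAtStalk_eq_of_mem_associatedPrimes`). If `I` were contained in one associated prime,
  `R ⧸ I` would have positive rank there, hence at all of them; being killed by `I`, it could be
  free only if `I` vanished at every associated prime, so that `I = 0`.
* By prime avoidance some `x ∈ I \ 𝔪 I` is regular, and `x ∉ 𝔪²` by the hypothesis on `I`.
* A finitely generated `R ⧸ (x)`-module of finite projective dimension over `R` has finite
  projective dimension over `R ⧸ (x)` (`hasProjectiveDimensionLE_quotient_span`, due to Nagata). So
  the hypotheses pass to `I ⧸ (x)` in `R ⧸ (x)`, which needs one generator fewer.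
-/

/-! ### Projective dimension and minimal free covers -/

theorem hasProjectiveDimensionLE_zero_iff_projective {R M : Type u} [CommRing R] [AddCommGroup M]
    [Module R M] :
    HasProjectiveDimensionLE (ModuleCat.of R M) 0 ↔ Module.Projective R M := by
  rw [← projective_iff_hasProjectiveDimensionLE_zero, ← IsProjective.iff_projective]

theorem hasProjectiveDimensionLE_succ_iff_ker {R F M : Type u} [CommRing R] [AddCommGroup F]
    [Module R F] [Module.Projective R F] [AddCommGroup M] [Module R M] (f : F →ₗ[R] M)
    (hf : Function.Surjective f) (n : ℕ) :
    HasProjectiveDimensionLE (ModuleCat.of R M) (n + 1) ↔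
      HasProjectiveDimensionLE (ModuleCat.of R (LinearMap.ker f)) n :=
  (LinearMap.shortExact_shortComplexKer hf).hasProjectiveDimensionLT_X₃_iff n
    (by dsimp; infer_instance)

/-- Minimal free cover: a finitely generated module over a local ring is the image of a finite free
module under a map whose kernel has all coordinates in the maximal ideal. -/
theorem exists_surjective_ker_le_maximalIdeal_smul {R M : Type u} [CommRing R] [IsLocalRing R]
    [AddCommGroup M] [Module R M] [Module.Finite R M] :
    ∃ (ι : Type u) (_ : Finite ι) (f : (ι → R) →ₗ[R] M), Function.Surjective f ∧
      ∀ v ∈ LinearMap.ker f, ∀ i, v i ∈ maximalIdeal R := by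
  let w := Module.Free.chooseBasis (ResidueField R) (ResidueField R ⊗[R] M)
  let ι := Module.Free.ChooseBasisIndex (ResidueField R) (ResidueField R ⊗[R] M)
  obtain ⟨v, hv⟩ := (TensorProduct.mk_surjective R M (ResidueField R)
    Ideal.Quotient.mk_surjective).comp_left w
  have hspan := span_eq_top_of_tmul_eq_basis v w (congr_fun hv)
  refine ⟨ι, inferInstance, Fintype.linearCombination R v, ?_, fun a ha i ↦ ?_⟩
  · rw [← LinearMap.range_eq_top, Fintype.range_linearCombination, hspan]
  · rw [LinearMap.mem_ker, Fintype.linearCombination_apply] at ha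
    have h : ∑ j, (residue R (a j)) • w j = 0 := by
      have := congrArg (TensorProduct.mk R (ResidueField R) M 1) ha
      rw [map_sum, map_zero] at this
      rw [← this]
      refine Finset.sum_congr rfl fun j _ ↦ ?_
      rw [← congr_fun hv j, map_smul]
      exact algebraMap_smul (ResidueField R) (a j) _
    have := (Fintype.linearIndependent_iff.mp w.linearIndependent) _ h i
    rwa [residue_eq_zero_iff] at this

/-- Over a local ring whose maximal ideal is killed by a nonzero element (that is, of depth zero),
a finitely generated module of finite projective dimension is free. -/
theorem projective_of_hasProjectiveDimensionLE_of_mul_eq_zero {R : Type u} [CommRing R]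
    [IsLocalRing R] [IsNoetherianRing R] {s : R} (hs0 : s ≠ 0)
    (hs : ∀ a ∈ maximalIdeal R, s * a = 0) (n : ℕ) {M : Type u} [AddCommGroup M]
    [Module R M] [Module.Finite R M] (h : HasProjectiveDimensionLE (ModuleCat.of R M) n) :
    Module.Projective R M := by
  induction n generalizing M with
  | zero => exact hasProjectiveDimensionLE_zero_iff_projective.mp h
  | succ n ih =>
    obtain ⟨ι, _, f, hf, hker⟩ := exists_surjective_ker_le_maximalIdeal_smul (R := R) (M := M)
    have hK : Module.Projective R (LinearMap.ker f) :=
      ih ((hasProjectiveDimensionLE_succ_iff_ker f hf n).mp h)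
    have : Module.Free R (LinearMap.ker f) := Module.free_of_flat_of_isLocalRing
    have hsub : Subsingleton (LinearMap.ker f) := by
      by_contra hnt
      rw [not_subsingleton_iff_nontrivial] at hnt
      have : s ∈ Module.annihilator R (LinearMap.ker f) := by
        refine Module.mem_annihilator.mpr fun v ↦ Subtype.ext (funext fun i ↦ ?_)
        exact hs _ (hker v.1 v.2 i)
      rw [Module.annihilator_eq_bot.mpr inferInstance] at this
      exact hs0 this
    exact Module.Projective.of_equiv (LinearEquiv.ofBijective f
      ⟨LinearMap.ker_eq_bot.mp ((Submodule.subsingleton_iff_eq_bot).mp hsub), hf⟩)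

/-! ### Rank at the associated primes -/

theorem Module.finrank_eq_add_of_exact {A X Y Z : Type*} [CommRing A] [Nontrivial A]
    [AddCommGroup X] [Module A X] [AddCommGroup Y] [Module A Y] [AddCommGroup Z] [Module A Z]
    [Module.Free A X] [Module.Finite A X] [Module.Free A Z] [Module.Finite A Z]
    {f : X →ₗ[A] Y} {g : Y →ₗ[A] Z} (hf : Function.Injective f) (hfg : Function.Exact f g)
    (hg : Function.Surjective g) :
    Module.finrank A Y = Module.finrank A X + Module.finrank A Z := by
  obtain ⟨l, hl⟩ := Module.projective_lifting_property g LinearMap.id hg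
  obtain ⟨e, -⟩ := hfg.splitSurjectiveEquiv hf ⟨l, hl⟩
  rw [e.finrank_eq, Module.finrank_prod]

/-- The localization of `R` at an associated prime has depth zero, so modules of finite projective
dimension become free there. -/
theorem free_localizedModule_of_mem_associatedPrimes {R : Type u} [CommRing R] [IsNoetherianRing R]
    {p : Ideal R} [p.IsPrime] (hp : p ∈ associatedPrimes R R) (n : ℕ) {M : Type u} [AddCommGroup M]
    [Module R M] [Module.Finite R M] (h : HasProjectiveDimensionLE (ModuleCat.of R M) n) :
    Module.Free (Localization.AtPrime p) (LocalizedModule p.primeCompl M) := by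
  obtain ⟨-, s, hs⟩ := isAssociatedPrime_iff.mp hp
  have hs' : ∀ a : R, a ∈ p ↔ a * s = 0 := fun a ↦ by
    rw [hs, Submodule.mem_colon_singleton, smul_eq_mul, Ideal.mem_bot]
  have hloc := ModuleCat.localizedModule_hasProjectiveDimensionLE n p.primeCompl (ModuleCat.of R M)
  have hloc' : HasProjectiveDimensionLE
      (ModuleCat.of (Localization.AtPrime p) (LocalizedModule p.primeCompl M)) n :=
    ModuleCat.hasProjectiveDimensionLE_of_linearEquiv
      (M := (ModuleCat.of R M).localizedModule p.primeCompl)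
      (N := ModuleCat.of (Localization.AtPrime p) (LocalizedModule p.primeCompl M))
      (Shrink.linearEquiv (Localization.AtPrime p) (LocalizedModule p.primeCompl M) :
        Shrink.{u} (LocalizedModule p.primeCompl M) ≃ₗ[Localization.AtPrime p] _) n
  have hproj := projective_of_hasProjectiveDimensionLE_of_mul_eq_zero
    (s := algebraMap R (Localization.AtPrime p) s) ?_ ?_ n hloc'
  · exact Module.free_of_flat_of_isLocalRing
  · rw [Ne, IsLocalization.map_eq_zero_iff p.primeCompl]
    rintro ⟨t, ht⟩
    exact t.2 ((hs' _).mpr ht)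
  · intro a ha
    rw [← Localization.AtPrime.map_eq_maximalIdeal] at ha
    induction ha using Submodule.span_induction with
    | mem x hx =>
      obtain ⟨y, hy, rfl⟩ := hx
      rw [← map_mul, mul_comm, (hs' y).mp hy, map_zero]
    | zero => exact mul_zero _
    | add x y _ _ hx hy => rw [mul_add, hx, hy, add_zero]
    | smul a x _ hx => rw [smul_eq_mul, mul_left_comm, hx, mul_zero]

/-- A module of finite projective dimension over a local ring has the same rank at every
associated prime of the ring. -/
theorem rankAtStalk_eq_of_mem_associatedPrimes {R : Type u} [CommRing R] [IsLocalRing R]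
    [IsNoetherianRing R] {p q : PrimeSpectrum R} (hp : p.asIdeal ∈ associatedPrimes R R)
    (hq : q.asIdeal ∈ associatedPrimes R R) (n : ℕ) {M : Type u} [AddCommGroup M]
    [Module R M] [Module.Finite R M] (h : HasProjectiveDimensionLE (ModuleCat.of R M) n) :
    Module.rankAtStalk M p = Module.rankAtStalk M q := by
  induction n generalizing M with
  | zero =>
    have := hasProjectiveDimensionLE_zero_iff_projective.mp h
    have : Module.Free R M := Module.free_of_flat_of_isLocalRing
    simp [Module.rankAtStalk_eq_finrank_of_free]
  | succ n ih =>
    obtain ⟨ι, _, f, hf, -⟩ := exists_surjective_ker_le_maximalIdeal_smul (R := R) (M := M)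
    have hK := (hasProjectiveDimensionLE_succ_iff_ker f hf n).mp h
    have key : ∀ r : PrimeSpectrum R, r.asIdeal ∈ associatedPrimes R R →
        Module.finrank R (ι → R) =
          Module.rankAtStalk (LinearMap.ker f) r + Module.rankAtStalk M r := fun r hr ↦ by
      have := free_localizedModule_of_mem_associatedPrimes hr _ h
      have := free_localizedModule_of_mem_associatedPrimes hr _ hK
      have hrank : Module.rankAtStalk (ι → R) r = Module.finrank R (ι → R) := by
        simp [Module.rankAtStalk_eq_finrank_of_free]
      let S := r.asIdeal.primeCompl
      rw [← hrank]
      exact Module.finrank_eq_add_of_exact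
        (f := IsLocalizedModule.mapExtendScalars S (LocalizedModule.mkLinearMap S _)
          (LocalizedModule.mkLinearMap S _) (Localization S) (LinearMap.ker f).subtype)
        (g := IsLocalizedModule.mapExtendScalars S (LocalizedModule.mkLinearMap S _)
          (LocalizedModule.mkLinearMap S _) (Localization S) f)
        (IsLocalizedModule.map_injective S _ _ _ (Submodule.subtype_injective _))
        (LocalizedModule.map_exact S _ _ (LinearMap.exact_subtype_ker_map f))
        (IsLocalizedModule.map_surjective S _ _ f hf)
    have := key p hp
    have := key q hq
    have := ih hK
    omega

/-- A nonzero ideal `I` for which `R ⧸ I` has finite projective dimension lies in no associated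
prime, that is, it contains a regular element. -/
theorem not_le_of_mem_associatedPrimes {R : Type u} [CommRing R] [IsLocalRing R]
    [IsNoetherianRing R] {I : Ideal R} (hI : I ≠ ⊥) {n : ℕ}
    (h : HasProjectiveDimensionLE (ModuleCat.of R (R ⧸ I)) n) {p : Ideal R}
    (hp : p ∈ associatedPrimes R R) : ¬ I ≤ p := by
  intro hle
  have hprime : p.IsPrime := hp.isPrime
  -- As `I ≤ p`, the free module `(R ⧸ I)_p` is nonzero.
  have hpos : 0 < Module.rankAtStalk (R ⧸ I) (⟨p, hprime⟩ : PrimeSpectrum R) := by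
    have := free_localizedModule_of_mem_associatedPrimes hp _ h
    have : Nontrivial (LocalizedModule p.primeCompl (R ⧸ I)) := by
      rw [← Module.mem_support_iff (p := (⟨p, hprime⟩ : PrimeSpectrum R)),
        Module.support_eq_zeroLocus, Ideal.annihilator_quotient]
      exact hle
    exact (Module.finrank_pos_iff_of_free (Localization.AtPrime p) _).mpr inferInstance
  -- An associated prime `q` of `R i ≤ R`, for `0 ≠ i ∈ I`: here `i` does not vanish at `q`.
  obtain ⟨i, hi, hi0⟩ := Submodule.exists_mem_ne_zero_of_ne_bot hI
  have hnt : Nontrivial (Submodule.span R {i}) :=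
    Submodule.nontrivial_span_singleton hi0
  obtain ⟨q, hq⟩ := associatedPrimes.nonempty R (Submodule.span R {i})
  have hqR : q ∈ associatedPrimes R R :=
    associatedPrimes.subset_of_injective (f := (Submodule.span R {i}).subtype)
      (Submodule.subtype_injective _) hq
  have hqprime : q.IsPrime := hq.isPrime
  rw [rankAtStalk_eq_of_mem_associatedPrimes (q := ⟨q, hqprime⟩) hp hqR n h] at hpos
  have hfree := free_localizedModule_of_mem_associatedPrimes hqR _ h
  have hnt' : Nontrivial (LocalizedModule q.primeCompl (R ⧸ I)) :=
    Module.nontrivial_of_finrank_pos (R := Localization.AtPrime q) hpos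
  -- But `i` kills the module `(R ⧸ I)_q`, which is free and nonzero.
  have hann : algebraMap R (Localization.AtPrime q) i ∈
      Module.annihilator (Localization.AtPrime q) (LocalizedModule q.primeCompl (R ⧸ I)) := by
    refine Module.mem_annihilator.mpr fun m ↦ ?_
    induction m using LocalizedModule.induction_on with
    | h m s =>
      rw [algebraMap_smul, LocalizedModule.smul'_mk]
      have : i • m = 0 := by
        obtain ⟨r, rfl⟩ := Ideal.Quotient.mk_surjective m
        rw [← Ideal.Quotient.mk_eq_mk, ← Submodule.Quotient.mk_smul, Submodule.Quotient.mk_eq_zero]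
        exact I.mul_mem_right r hi
      rw [this, LocalizedModule.zero_mk]
  rw [Module.annihilator_eq_bot.mpr inferInstance, Ideal.mem_bot,
    IsLocalization.map_eq_zero_iff q.primeCompl] at hann
  obtain ⟨t, ht⟩ := hann
  obtain ⟨-, x, hx⟩ := isAssociatedPrime_iff.mp hq
  refine t.2 (hx.ge (Submodule.mem_colon_singleton.mpr ?_))
  obtain ⟨a, ha⟩ := Submodule.mem_span_singleton.mp x.2
  refine Submodule.mem_bot R |>.mpr (Subtype.ext ?_)
  change (t : R) * x.1 = 0
  rw [← ha, smul_eq_mul, mul_left_comm, ht, mul_zero]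

/-! ### Projective dimension modulo a regular element -/

theorem hasProjectiveDimensionLE_one_quotSMulTop {R F : Type u} [CommRing R] [AddCommGroup F]
    [Module R F] [Module.Projective R F] {x : R} (hx : IsSMulRegular F x) :
    HasProjectiveDimensionLE (ModuleCat.of R (QuotSMulTop x F)) 1 := by
  have h := hasProjectiveDimensionLE_zero_iff_projective.mpr ‹Module.Projective R F›
  exact (hx.smulShortComplex_shortExact (M := ModuleCat.of R F)).hasProjectiveDimensionLT_X₃ 1 h
    (hasProjectiveDimensionLT_of_ge (ModuleCat.of R F) 1 2 (by norm_num))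

section ChangeOfRings

variable {R : Type u} [CommRing R] {x : R} {M : Type u} [AddCommGroup M] [Module R M]
  [Module (R ⧸ Ideal.span {x}) M] [IsScalarTower R (R ⧸ Ideal.span {x}) M]

theorem smul_eq_zero_of_module_quotient_span (m : M) : x • m = 0 := by
  rw [← algebraMap_smul (R ⧸ Ideal.span {x}) x m, Ideal.Quotient.algebraMap_eq,
    Ideal.Quotient.eq_zero_iff_mem.mpr (Ideal.mem_span_singleton_self x), zero_smul]

open Pointwise in
/-- The `R ⧸ (x)`-linear map from `F ⧸ xF` induced by an `R`-linear map from `F` to a module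
over `R ⧸ (x)`. -/
noncomputable def quotSMulTopLift (x : R) {F : Type u} [AddCommGroup F] [Module R F] {M : Type u}
    [AddCommGroup M] [Module R M] [Module (R ⧸ Ideal.span {x}) M]
    [IsScalarTower R (R ⧸ Ideal.span {x}) M] (f : F →ₗ[R] M) :
    QuotSMulTop x F →ₗ[R ⧸ Ideal.span {x}] M :=
  LinearMap.extendScalarsOfSurjective (R := R) Ideal.Quotient.mk_surjective
    (Submodule.liftQ (x • (⊤ : Submodule R F)) f fun v hv ↦ by
      obtain ⟨w, -, rfl⟩ := hv
      exact (f.map_smul x w).trans (smul_eq_zero_of_module_quotient_span _))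

theorem exists_quotSMulTop_surjective [Module.Finite R M] :
    ∃ (n : ℕ) (g : QuotSMulTop x (Fin n → R) →ₗ[R ⧸ Ideal.span {x}] M), Function.Surjective g := by
  obtain ⟨n, f, hf⟩ := Module.Finite.exists_fin' R M
  refine ⟨n, quotSMulTopLift x f, fun m ↦ ?_⟩
  obtain ⟨v, rfl⟩ := hf m
  exact ⟨Submodule.Quotient.mk v, rfl⟩

theorem isSMulRegular_fin_fun (hx : IsSMulRegular R x) (n : ℕ) : IsSMulRegular (Fin n → R) x :=
  fun _ _ h ↦ funext fun i ↦ hx (congr_fun h i)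

/-- For `x` regular, projective dimension grows at most by one from `R ⧸ (x)` to `R`. -/
theorem hasProjectiveDimensionLE_succ_of_quotient_span [IsNoetherianRing R]
    (hx : IsSMulRegular R x) [Module.Finite R M] (n : ℕ)
    (h : HasProjectiveDimensionLE (ModuleCat.of (R ⧸ Ideal.span {x}) M) n) :
    HasProjectiveDimensionLE (ModuleCat.of R M) (n + 1) := by
  induction n generalizing M with
  | zero =>
    obtain ⟨k, g, hg⟩ := exists_quotSMulTop_surjective (x := x) (M := M)
    have hproj := hasProjectiveDimensionLE_zero_iff_projective.mp h
    obtain ⟨l, hl⟩ := Module.projective_lifting_property g LinearMap.id hg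
    have := hasProjectiveDimensionLE_one_quotSMulTop (isSMulRegular_fin_fun hx k)
    exact Retract.hasProjectiveDimensionLT (Y := ModuleCat.of R (QuotSMulTop x (Fin k → R)))
      { i := ModuleCat.ofHom (l.restrictScalars R)
        r := ModuleCat.ofHom (g.restrictScalars R)
        retract := by
          ext m
          exact LinearMap.congr_fun hl m } 2
  | succ n ih =>
    obtain ⟨k, g, hg⟩ := exists_quotSMulTop_surjective (x := x) (M := M)
    have : IsScalarTower R (R ⧸ Ideal.span {x}) (LinearMap.ker g) :=
      ⟨fun a b v ↦ Subtype.ext (smul_assoc a b v.1)⟩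
    have : Module.Finite R (LinearMap.ker g) :=
      inferInstanceAs (Module.Finite R (LinearMap.ker (g.restrictScalars R)))
    have hK := ih ((hasProjectiveDimensionLE_succ_iff_ker g hg n).mp h)
    have hP := hasProjectiveDimensionLE_one_quotSMulTop (isSMulRegular_fin_fun hx k)
    exact (LinearMap.shortExact_shortComplexKer
      (f := g.restrictScalars R) hg).hasProjectiveDimensionLT_X₃ (n + 2)
      hK (hasProjectiveDimensionLT_of_ge _ 2 (n + 3) (by omega))

end ChangeOfRings

/-- Injectivity of `f ⊗ k`, read as injectivity of `F ⧸ 𝔪 F → N ⧸ 𝔪 N`. -/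
theorem lTensor_residueField_injective_of_mem_smul_top {R F N : Type u} [CommRing R]
    [IsLocalRing R] [AddCommGroup F] [Module R F]
    [AddCommGroup N] [Module R N] (f : F →ₗ[R] N)
    (h : ∀ v, f v ∈ maximalIdeal R • (⊤ : Submodule R N) →
      v ∈ maximalIdeal R • (⊤ : Submodule R F)) :
    Function.Injective (f.lTensor (ResidueField R)) := by
  have key : ∀ {L : Type u} [AddCommGroup L] [Module R L] (v : L),
      (1 : ResidueField R) ⊗ₜ[R] v = 0 ↔ v ∈ maximalIdeal R • (⊤ : Submodule R L) :=
      fun {L} _ _ v ↦ by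
    have := (TensorProduct.quotTensorEquivQuotSMul L (maximalIdeal R)).map_eq_zero_iff
      (x := (1 : R ⧸ maximalIdeal R) ⊗ₜ[R] v)
    rw [← Submodule.Quotient.mk_eq_zero]
    refine this.symm.trans ?_
    rw [← map_one (Ideal.Quotient.mk (maximalIdeal R)),
      TensorProduct.quotTensorEquivQuotSMul_mk_tmul, one_smul]
  rw [← LinearMap.ker_eq_bot, LinearMap.ker_eq_bot']
  intro t ht
  obtain ⟨v, rfl⟩ := TensorProduct.mk_surjective R F (ResidueField R) Ideal.Quotient.mk_surjective t
  exact (key v).mpr (h v ((key _).mp ht))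

section Descent

variable {R : Type u} [CommRing R] [IsLocalRing R] [IsNoetherianRing R] {x : R}

/-- Let `M` be an `R ⧸ (x)`-module with `x ∉ 𝔪²`, of projective dimension at most one over `R`. Then
it is projective over `R ⧸ (x)`. Indeed, if `0 → N → F → M → 0` is a minimal free resolution,
multiplication by `x` maps `F` to `N`. It is injective modulo `𝔪`, because `N ⊆ 𝔪 F` and `x ∉ 𝔪²`,
and therefore splits. The induced map `M = F ⧸ N → N ⧸ xN` then splits too, and `N ⧸ xN` is free
over `R ⧸ (x)`. -/
theorem projective_quotient_of_hasProjectiveDimensionLE_one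
    (hx2 : x ∉ maximalIdeal R ^ 2) {M : Type u} [AddCommGroup M] [Module R M]
    [Module (R ⧸ Ideal.span {x}) M] [IsScalarTower R (R ⧸ Ideal.span {x}) M] [Module.Finite R M]
    (h : HasProjectiveDimensionLE (ModuleCat.of R M) 1) :
    Module.Projective (R ⧸ Ideal.span {x}) M := by
  obtain ⟨ι, _, f, hf, hker⟩ := exists_surjective_ker_le_maximalIdeal_smul (R := R) (M := M)
  have hN := hasProjectiveDimensionLE_zero_iff_projective.mp
    ((hasProjectiveDimensionLE_succ_iff_ker f hf 0).mp h)
  have : Module.Free R (LinearMap.ker f) := Module.free_of_flat_of_isLocalRing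
  -- Multiplication by `x`, as a map from the free cover to the kernel.
  let μ : (ι → R) →ₗ[R] LinearMap.ker f :=
    (LinearMap.lsmul R (ι → R) x).codRestrict _ fun v ↦
      (f.map_smul x v).trans (smul_eq_zero_of_module_quotient_span _)
  have hμ : Function.Injective (μ.lTensor (ResidueField R)) := by
    refine lTensor_residueField_injective_of_mem_smul_top μ fun v hv ↦ ?_
    have hsq : ∀ w ∈ maximalIdeal R • (⊤ : Submodule R (LinearMap.ker f)), ∀ i,
        w.1 i ∈ maximalIdeal R ^ 2 := fun w hw i ↦ by
      induction hw using Submodule.smul_induction_on' with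
      | smul a ha n hn =>
        rw [pow_two]
        exact Ideal.mul_mem_mul ha (hker n.1 n.2 i)
      | add y hy z hz h₁ h₂ => exact Ideal.add_mem _ h₁ h₂
    have hv' : ∀ i, v i ∈ maximalIdeal R := fun i ↦ by
      by_contra hu
      have hu : IsUnit (v i) := by simpa using hu
      have : x * v i ∈ maximalIdeal R ^ 2 := hsq _ hv i
      exact hx2 ((Ideal.mul_unit_mem_iff_mem _ hu).mp this)
    classical
    cases nonempty_fintype ι
    rw [pi_eq_sum_univ' v]
    exact Submodule.sum_mem _ fun i _ ↦ Submodule.smul_mem_smul (hv' i) trivial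
  obtain ⟨ρ, hρ⟩ :=
    (IsLocalRing.split_injective_iff_lTensor_residueField_injective μ).mpr hμ
  let s := quotSMulTopLift x (f ∘ₗ ρ)
  let i₀ : M →ₗ[R] QuotSMulTop x (LinearMap.ker f) :=
    (LinearMap.ker f).liftQ ((Submodule.mkQ _) ∘ₗ μ) (fun v hv ↦ by
      rw [LinearMap.mem_ker, LinearMap.comp_apply, Submodule.mkQ_apply,
        Submodule.Quotient.mk_eq_zero]
      exact ⟨⟨v, hv⟩, trivial, rfl⟩) ∘ₗ (f.quotKerEquivOfSurjective hf).symm.toLinearMap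
  let i := LinearMap.extendScalarsOfSurjective (R := R)
    (S := R ⧸ Ideal.span {x}) Ideal.Quotient.mk_surjective i₀
  refine Module.Projective.of_split i s (LinearMap.ext fun m ↦ ?_)
  obtain ⟨v, rfl⟩ := hf m
  have : i (f v) = Submodule.Quotient.mk (μ v) := by
    change i₀ (f v) = _
    have : (f.quotKerEquivOfSurjective hf).symm (f v) = Submodule.Quotient.mk v := by
      rw [LinearEquiv.symm_apply_eq]; rfl
    simp only [i₀, LinearMap.comp_apply, LinearEquiv.coe_coe, this]
    rfl
  rw [LinearMap.comp_apply, this]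
  change f (ρ (μ v)) = f v
  exact congrArg f (LinearMap.congr_fun hρ v)

/-- Nagata: projective dimension drops by one from `R` to `R ⧸ (x)`, for `x` regular and not in
`𝔪²`. The induction starts at projective dimension one over `R`, not zero, because the free
`R ⧸ (x)`-modules that cover `M` have projective dimension one over `R`. -/
theorem hasProjectiveDimensionLE_quotient_span (hx : IsSMulRegular R x)
    (hx2 : x ∉ maximalIdeal R ^ 2) (n : ℕ) {M : Type u} [AddCommGroup M] [Module R M]
    [Module (R ⧸ Ideal.span {x}) M] [IsScalarTower R (R ⧸ Ideal.span {x}) M] [Module.Finite R M]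
    (h : HasProjectiveDimensionLE (ModuleCat.of R M) (n + 1)) :
    HasProjectiveDimensionLE (ModuleCat.of (R ⧸ Ideal.span {x}) M) n := by
  induction n generalizing M with
  | zero =>
    exact hasProjectiveDimensionLE_zero_iff_projective.mpr
      (projective_quotient_of_hasProjectiveDimensionLE_one hx2 h)
  | succ n ih =>
    obtain ⟨k, g, hg⟩ := exists_quotSMulTop_surjective (x := x) (M := M)
    rw [hasProjectiveDimensionLE_succ_iff_ker g hg n]
    have : IsScalarTower R (R ⧸ Ideal.span {x}) (LinearMap.ker g) :=
      ⟨fun a b v ↦ Subtype.ext (smul_assoc a b v.1)⟩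
    have : Module.Finite R (LinearMap.ker g) :=
      inferInstanceAs (Module.Finite R (LinearMap.ker (g.restrictScalars R)))
    have hP := hasProjectiveDimensionLE_one_quotSMulTop (isSMulRegular_fin_fun hx k)
    have hK : HasProjectiveDimensionLE (ModuleCat.of R (LinearMap.ker g)) (n + 1) :=
      (LinearMap.shortExact_shortComplexKer
        (f := g.restrictScalars R) hg).hasProjectiveDimensionLT_X₁ (n + 2)
        (hasProjectiveDimensionLT_of_ge _ 2 (n + 2) (by omega)) h
    exact ih hK

end Descent

/-! ### Ideals generated by regular sequences -/

/-- Exchange: an element of `I \ 𝔪 I` can replace one of the generators of `I`, since in an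
expression of it by the generators some coefficient is a unit. -/
theorem exists_span_singleton_sup_span_eq {R : Type*} [CommRing R] [IsLocalRing R] {I : Ideal R}
    {s : Finset R} (hs : Ideal.span (s : Set R) = I) {x : R} (hx : x ∈ I)
    (hx' : x ∉ maximalIdeal R * I) :
    ∃ t : Finset R, t.card < s.card ∧ Ideal.span {x} ⊔ Ideal.span (t : Set R) = I := by
  classical
  subst hs
  obtain ⟨a, ha⟩ := Submodule.mem_span_finset'.mp hx
  obtain ⟨g, hg⟩ : ∃ g : s, IsUnit (a g) := by
    by_contra! h
    refine hx' (ha ▸ Submodule.sum_mem _ fun g _ ↦ ?_)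
    exact Ideal.mul_mem_mul ((mem_maximalIdeal _).mpr (h g)) (Ideal.subset_span g.2)
  refine ⟨s.erase g, Finset.card_erase_lt_of_mem g.2, le_antisymm (sup_le ?_ ?_) ?_⟩
  · rwa [Ideal.span_singleton_le_iff_mem]
  · exact Ideal.span_mono (Finset.coe_subset.mpr (Finset.erase_subset _ _))
  · set J := Ideal.span {x} ⊔ Ideal.span (s.erase g.1 : Set R)
    have hmem : ∀ r ∈ s, r ≠ g → r ∈ J := fun r hr hne ↦
      Ideal.mem_sup_right (Ideal.subset_span (by simp [hr, hne]))
    refine Ideal.span_le.mpr fun r hr ↦ ?_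
    by_cases hrg : r = g
    · subst hrg
      have hsum : x - ∑ i ∈ Finset.univ.erase g, a i • (i : R) ∈ J :=
        J.sub_mem (Ideal.mem_sup_left (Ideal.mem_span_singleton_self x)) <|
          J.sum_mem fun i hi ↦ J.mul_mem_left _
            (hmem i i.2 fun h ↦ (Finset.mem_erase.mp hi).1 (Subtype.ext h))
      rw [← ha, ← Finset.add_sum_erase _ _ (Finset.mem_univ g), add_sub_cancel_right,
        smul_eq_mul] at hsum
      exact (Ideal.unit_mul_mem_iff_mem _ hg).mp hsum
    · exact hmem r hr hrg

/-- An ideal that lies in no associated prime has a minimal generator that is regular. -/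
theorem exists_isSMulRegular_notMem_maximalIdeal_mul {R : Type*} [CommRing R] [IsLocalRing R]
    [IsNoetherianRing R] {I : Ideal R} (hI : I ≠ ⊥)
    (h : ∀ p ∈ associatedPrimes R R, ¬ I ≤ p) :
    ∃ x ∈ I, x ∉ maximalIdeal R * I ∧ IsSMulRegular R x := by
  by_contra! hcon
  have hcover : (I : Set R) ⊆
      ⋃ J ∈ insert (maximalIdeal R * I) (associatedPrimes R R), (J : Set R) := by
    intro x hx
    rw [Set.biUnion_insert]
    by_cases hxm : x ∈ maximalIdeal R * I
    · exact Or.inl hxm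
    · right
      change x ∈ ⋃ p ∈ associatedPrimes R R, (p : Set R)
      rw [biUnion_associatedPrimes_eq_compl_regular]
      exact hcon x hx hxm
  obtain ⟨J, rfl | hJ, hle⟩ := (Ideal.subset_union_prime_finite (f := fun J ↦ J)
    ((associatedPrimes.finite R R).insert _)
    (maximalIdeal R * I) (maximalIdeal R * I)
    (fun J hJ hne _ ↦ (hJ.resolve_left hne).isPrime)).mp hcover
  · exact hI (Submodule.eq_bot_of_le_smul_of_le_jacobson_bot (maximalIdeal R) I
      (IsNoetherian.noetherian I) hle (jacobson_eq_maximalIdeal ⊥ bot_ne_top).ge)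
  · exact h J hJ hle

/-- An ideal is generated by a regular sequence if its image modulo some regular element `x` of it
is. -/
theorem GeneratedByRegularSequence.of_map_quotient_span {R : Type u} [CommRing R] {I : Ideal R}
    {x : R} (hxI : x ∈ I) (hx : IsSMulRegular R x)
    (h : GeneratedByRegularSequence (I.map (Ideal.Quotient.mk (Ideal.span {x})))) :
    GeneratedByRegularSequence I := by
  obtain ⟨rs', hreg, hgen⟩ := h
  obtain ⟨rs, rfl⟩ := Ideal.Quotient.mk_surjective.list_map rs'
  refine ⟨x :: rs, ?_, ?_⟩
  · rw [RingTheory.Sequence.isRegular_cons_iff']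
    refine ⟨hx, ?_⟩
    let e : QuotSMulTop x R ≃ₗ[R] R ⧸ Ideal.span {x} := Submodule.quotEquivOfEq _ _ (by
      rw [← Submodule.ideal_span_singleton_smul, smul_eq_mul, Ideal.mul_top])
    exact ((e.extendScalarsOfSurjective (S := R ⧸ Ideal.span {x})
      Ideal.Quotient.mk_surjective).isRegular_congr _).mpr hreg
  · rw [← Ideal.map_ofList] at hgen
    have := congrArg (Ideal.comap (Ideal.Quotient.mk (Ideal.span {x}))) hgen
    rw [Ideal.comap_map_of_surjective' _ Ideal.Quotient.mk_surjective,
      Ideal.comap_map_of_surjective' _ Ideal.Quotient.mk_surjective, Ideal.mk_ker] at this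
    rw [Ideal.ofList_cons, sup_comm, this, sup_eq_left, Ideal.span_singleton_le_iff_mem]
    exact hxI

/-- The induction on the number of generators behind
`generatedByRegularSequence_of_projectiveDimension_ne_top`. -/
theorem generatedByRegularSequence_of_hasProjectiveDimensionLE (k : ℕ) {R : Type u} [CommRing R]
    [IsLocalRing R] [IsNoetherianRing R] {I : Ideal R} {s : Finset R} (hsk : s.card ≤ k)
    (hs : Ideal.span (s : Set R) = I) (hIm : I ≤ maximalIdeal R)
    (hI : I ⊓ maximalIdeal R ^ 2 ≤ maximalIdeal R * I) (n : ℕ)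
    (h : HasProjectiveDimensionLE (ModuleCat.of R (R ⧸ I)) n) : GeneratedByRegularSequence I := by
  classical
  induction k generalizing R with
  | zero =>
    obtain rfl : s = ∅ := Finset.card_eq_zero.mp (Nat.le_zero.mp hsk)
    refine ⟨[], RingTheory.Sequence.IsRegular.nil R R, ?_⟩
    simp [← hs]
  | succ k ih =>
    by_cases hI0 : I = ⊥
    · exact ⟨[], RingTheory.Sequence.IsRegular.nil R R, by simp [hI0]⟩
    obtain ⟨x, hxI, hxmI, hx⟩ := exists_isSMulRegular_notMem_maximalIdeal_mul hI0
      fun p hp ↦ not_le_of_mem_associatedPrimes hI0 h hp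
    have hx2 : x ∉ maximalIdeal R ^ 2 := fun hmem ↦ hxmI (hI ⟨hxI, hmem⟩)
    obtain ⟨t, hts, htI⟩ := exists_span_singleton_sup_span_eq hs hxI hxmI
    have hspan : Ideal.span {x} ≤ I := (Ideal.span_singleton_le_iff_mem _).mpr hxI
    have hnt : Nontrivial (R ⧸ Ideal.span {x}) := Ideal.Quotient.nontrivial_iff.mpr
      (ne_top_of_le_ne_top (Ideal.IsPrime.ne_top inferInstance) (hspan.trans hIm))
    have hsurj : Function.Surjective (Ideal.Quotient.mk (Ideal.span {x})) :=
      Ideal.Quotient.mk_surjective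
    have hloc : IsLocalRing (R ⧸ Ideal.span {x}) := IsLocalRing.of_surjective' _ hsurj
    have hmax := map_maximalIdeal_of_surjective _ hsurj
    have hmap : I.map (Ideal.Quotient.mk (Ideal.span {x})) =
        Ideal.span (t.image (Ideal.Quotient.mk (Ideal.span {x})) : Finset _) := by
      rw [← htI, Ideal.map_sup, Ideal.map_quotient_self, bot_sup_eq, Ideal.map_span,
        Finset.coe_image]
    refine .of_map_quotient_span hxI hx (ih (s := t.image (Ideal.Quotient.mk (Ideal.span {x}))) ?_
      hmap.symm ?_ ?_ ?_)
    · exact Finset.card_image_le.trans (by omega)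
    · rw [← hmax]
      exact Ideal.map_mono hIm
    · rintro y ⟨hyI, hym⟩
      rw [← hmax, ← Ideal.map_pow] at hym
      obtain ⟨z, hz, rfl⟩ := (Ideal.mem_map_iff_of_surjective _ hsurj).mp hym
      have hzI : z ∈ I := by
        have : z ∈ (I.map (Ideal.Quotient.mk (Ideal.span {x}))).comap
          (Ideal.Quotient.mk (Ideal.span {x})) := hyI
        rwa [Ideal.comap_map_of_surjective' _ hsurj, Ideal.mk_ker, sup_eq_left.mpr hspan] at this
      rw [← hmax, ← Ideal.map_mul]
      exact Ideal.mem_map_of_mem _ (hI ⟨hzI, hz⟩)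
    · refine hasProjectiveDimensionLE_quotient_span hx hx2 n ?_
      have h' : HasProjectiveDimensionLE (ModuleCat.of R (R ⧸ I)) (n + 1) :=
        hasProjectiveDimensionLT_of_ge _ (n + 1) _ (by omega)
      exact ModuleCat.hasProjectiveDimensionLE_of_linearEquiv (M := ModuleCat.of R (R ⧸ I))
        (DoubleQuot.quotQuotEquivQuotOfLEₐ R hspan).symm.toLinearEquiv (n + 1)

/-- Over any noetherian local ring `R`, the condition `I ∩ 𝔪² ⊆ 𝔪 I` makes finiteness of the
projective dimension of `R ⧸ I` pass to the quotient by a regular element `x ∈ I \ 𝔪 I`: it forces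
`x ∉ 𝔪²`, and it persists in `R ⧸ (x)`. -/
theorem generatedByRegularSequence_of_projectiveDimension_ne_top {R : Type u} [CommRing R]
    [IsLocalRing R] [IsNoetherianRing R] {I : Ideal R} (hIm : I ≤ maximalIdeal R)
    (hI : I ⊓ maximalIdeal R ^ 2 ≤ maximalIdeal R * I)
    (h : projectiveDimension (ModuleCat.of R (R ⧸ I)) ≠ ⊤) : GeneratedByRegularSequence I := by
  obtain ⟨n, hn⟩ := (projectiveDimension_ne_top_iff _).mp h
  obtain ⟨s, hs⟩ := IsNoetherian.noetherian I
  exact generatedByRegularSequence_of_hasProjectiveDimensionLE s.card le_rfl hs hIm hI n hn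

/-! ### Modules over regular local rings -/

theorem exists_mem_maximalIdeal_notMem_sq {Q : Type*} [CommRing Q] [IsLocalRing Q]
    [IsNoetherianRing Q] (h : maximalIdeal Q ≠ ⊥) :
    ∃ x ∈ maximalIdeal Q, x ∉ maximalIdeal Q ^ 2 := by
  by_contra! hcon
  refine h (Submodule.eq_bot_of_le_smul_of_le_jacobson_bot (maximalIdeal Q) _
    (IsNoetherian.noetherian _) (fun x hx ↦ ?_) (jacobson_eq_maximalIdeal ⊥ bot_ne_top).ge)
  rw [smul_eq_mul, ← pow_two]
  exact hcon x hx

/-- The quotient of a regular local ring by an element of `𝔪 \ 𝔪²` is a regular local ring with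
smaller embedding dimension. -/
theorem isRegularLocalRing_quotient_span {Q : Type*} [CommRing Q] [IsRegularLocalRing Q] {x : Q}
    (hx : x ∈ maximalIdeal Q) (hx2 : x ∉ maximalIdeal Q ^ 2) :
    ∃ _ : IsRegularLocalRing (Q ⧸ Ideal.span {x}),
      (maximalIdeal (Q ⧸ Ideal.span {x})).spanFinrank < (maximalIdeal Q).spanFinrank := by
  classical
  have hnt : Nontrivial (Q ⧸ Ideal.span {x}) := Ideal.Quotient.nontrivial_iff.mpr
    (ne_top_of_le_ne_top (Ideal.IsPrime.ne_top inferInstance)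
      ((Ideal.span_singleton_le_iff_mem _).mpr hx))
  have hsurj : Function.Surjective (Ideal.Quotient.mk (Ideal.span {x})) :=
    Ideal.Quotient.mk_surjective
  have hloc : IsLocalRing (Q ⧸ Ideal.span {x}) := IsLocalRing.of_surjective' _ hsurj
  obtain ⟨s, hcard, hs⟩ := Submodule.FG.exists_span_finset_card_eq_spanFinrank
    (IsNoetherian.noetherian (maximalIdeal Q))
  obtain ⟨t, hts, ht⟩ := exists_span_singleton_sup_span_eq hs hx (by rwa [← pow_two])
  have hlt : (maximalIdeal (Q ⧸ Ideal.span {x})).spanFinrank < (maximalIdeal Q).spanFinrank := by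
    rw [← hcard]
    refine lt_of_le_of_lt ?_ hts
    rw [← map_maximalIdeal_of_surjective _ hsurj, ← ht, Ideal.map_sup, Ideal.map_quotient_self,
      bot_sup_eq, Ideal.map_span]
    refine (Submodule.spanFinrank_span_le_ncard_of_finite (t.finite_toSet.image _)).trans ?_
    exact (Set.ncard_image_le t.finite_toSet).trans (Set.ncard_coe_finset t).le
  refine ⟨.of_spanFinrank_maximalIdeal_le _ ?_, hlt⟩
  have hdim := ringKrullDim_le_ringKrullDim_quotient_add_card {x}
    (show ((({x} : Finset Q)) : Set Q) ⊆ Ring.jacobson Q by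
      rw [IsLocalRing.ringJacobson_eq_maximalIdeal]; simpa using hx)
  rw [← IsRegularLocalRing.spanFinrank_maximalIdeal, Finset.coe_singleton,
    Finset.card_singleton] at hdim
  have hlt' : (((maximalIdeal (Q ⧸ Ideal.span {x})).spanFinrank : ℕ) : WithBot ℕ∞) + 1 ≤
      ((maximalIdeal Q).spanFinrank : ℕ) := by exact_mod_cast hlt
  exact ENat.WithBot.add_le_add_one_right_iff.mp (by simpa using hlt'.trans hdim)

/-- Regular local rings are domains. By induction on the embedding dimension, `(x)` is prime for
every `x ∈ 𝔪 \ 𝔪²`, and prime avoidance gives such an `x` outside all minimal primes. -/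
theorem IsRegularLocalRing.isDomain {Q : Type*} [CommRing Q] [IsRegularLocalRing Q] :
    IsDomain Q := by
  induction hd : (maximalIdeal Q).spanFinrank using Nat.strong_induction_on generalizing Q with
  | h d ih =>
  by_cases hm : maximalIdeal Q = ⊥
  · have : (⊥ : Ideal Q).IsPrime := hm ▸ inferInstance
    exact IsDomain.of_bot_isPrime Q
  obtain ⟨x, hx, hx2, hxmin⟩ : ∃ x ∈ maximalIdeal Q, x ∉ maximalIdeal Q ^ 2 ∧
      ∀ p ∈ minimalPrimes Q, x ∉ p := by
    by_contra! hcon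
    have hcover : (maximalIdeal Q : Set Q) ⊆
        ⋃ J ∈ insert (maximalIdeal Q ^ 2) (minimalPrimes Q), (J : Set Q) := by
      intro x hx
      rw [Set.biUnion_insert]
      by_cases hx2 : x ∈ maximalIdeal Q ^ 2
      · exact Or.inl hx2
      · obtain ⟨p, hp, hxp⟩ := hcon x hx hx2
        exact Or.inr (Set.mem_biUnion hp hxp)
    obtain ⟨J, rfl | hJ, hle⟩ := (Ideal.subset_union_prime_finite (f := fun J ↦ J)
      ((minimalPrimes.finite_of_isNoetherianRing Q).insert _)
      (maximalIdeal Q ^ 2) (maximalIdeal Q ^ 2)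
      (fun J hJ hne _ ↦ (hJ.resolve_left hne).1.1)).mp hcover
    · obtain ⟨x, hx, hx2⟩ := exists_mem_maximalIdeal_notMem_sq hm
      exact hx2 (hle hx)
    · have hJp : J.IsPrime := hJ.1.1
      rw [← eq_of_le_of_ge hle (le_maximalIdeal hJp.ne_top), ← Ideal.height_eq_zero_iff] at hJ
      have hdim := maximalIdeal_height_eq_ringKrullDim (R := Q)
      rw [hJ, ← IsRegularLocalRing.spanFinrank_maximalIdeal] at hdim
      have : (maximalIdeal Q).spanFinrank = 0 := by exact_mod_cast hdim.symm
      exact hm ((Submodule.spanFinrank_eq_zero_iff_eq_bot (IsNoetherian.noetherian _)).mp this)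
  obtain ⟨hreg, hlt⟩ := isRegularLocalRing_quotient_span hx hx2
  have hdom : IsDomain (Q ⧸ Ideal.span {x}) := ih _ (hd ▸ hlt) rfl
  have hprime : (Ideal.span {x}).IsPrime := (Ideal.Quotient.isDomain_iff_prime _).mp hdom
  obtain ⟨p, hp, hpx⟩ := Ideal.exists_minimalPrimes_le (I := ⊥) (J := Ideal.span {x}) bot_le
  have hpp : p.IsPrime := hp.1.1
  -- A minimal prime `p ≤ (x)` with `x ∉ p` satisfies `p = x p`.
  have hp0 : p = ⊥ := by
    refine Submodule.eq_bot_of_le_smul_of_le_jacobson_bot (maximalIdeal Q) _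
      (IsNoetherian.noetherian _) (fun y hy ↦ ?_) (jacobson_eq_maximalIdeal ⊥ bot_ne_top).ge
    obtain ⟨z, rfl⟩ := Ideal.mem_span_singleton.mp (hpx hy)
    exact Submodule.smul_mem_smul hx ((hpp.mem_or_mem hy).resolve_left (hxmin p hp))
  exact @IsDomain.of_bot_isPrime Q _ (hp0 ▸ hpp)

/-- Finitely generated modules over a regular local ring have finite projective dimension. By
induction on the embedding dimension: an element `x ∈ 𝔪 \ 𝔪²` is regular on a syzygy `K` of `M`, and
`K ⧸ xK` is a module over the regular local ring `Q ⧸ (x)`. -/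
theorem IsRegularLocalRing.exists_hasProjectiveDimensionLE {Q : Type u} [CommRing Q]
    [IsRegularLocalRing Q] (M : Type u) [AddCommGroup M] [Module Q M] [Module.Finite Q M] :
    ∃ n : ℕ, HasProjectiveDimensionLE (ModuleCat.of Q M) n := by
  induction hd : (maximalIdeal Q).spanFinrank using Nat.strong_induction_on generalizing Q M with
  | h d ih =>
  obtain ⟨ι, _, f, hf, hker⟩ := exists_surjective_ker_le_maximalIdeal_smul (R := Q) (M := M)
  by_cases hm : maximalIdeal Q = ⊥
  · refine ⟨0, hasProjectiveDimensionLE_zero_iff_projective.mpr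
      (Module.Projective.of_equiv (LinearEquiv.ofBijective f ⟨?_, hf⟩))⟩
    refine LinearMap.ker_eq_bot.mp (LinearMap.ker_eq_bot'.mpr fun v hv ↦ funext fun i ↦ ?_)
    have := hker v hv i
    rwa [hm] at this
  obtain ⟨x, hx, hx2⟩ := exists_mem_maximalIdeal_notMem_sq hm
  obtain ⟨hreg, hlt⟩ := isRegularLocalRing_quotient_span hx hx2
  have := IsRegularLocalRing.isDomain (Q := Q)
  have hx0 : x ≠ 0 := fun h ↦ hx2 (h ▸ zero_mem _)
  have hxQ : IsSMulRegular Q x := fun a b h ↦ mul_left_cancel₀ hx0 h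
  have hxK : IsSMulRegular (LinearMap.ker f) x := fun a b h ↦
    Subtype.ext (funext fun i ↦ hxQ (congr_fun (congrArg Subtype.val h) i))
  have := Module.Finite.of_restrictScalars_finite Q (Q ⧸ Ideal.span {x})
    (QuotSMulTop x (LinearMap.ker f))
  obtain ⟨n, hn⟩ := ih _ (hd ▸ hlt) (QuotSMulTop x (LinearMap.ker f)) rfl
  have hn' := hasProjectiveDimensionLE_succ_of_quotient_span hxQ n hn
  rw [← projectiveDimension_le_iff] at hn'
  have heq := ModuleCat.projectiveDimension_quotSMulTop_eq_succ_of_isSMulRegular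
    (ModuleCat.of Q (LinearMap.ker f)) x hxK hx
  have hK : projectiveDimension (ModuleCat.of Q (LinearMap.ker f)) + 1 ≤ ((n : ℕ) + 1 : ℕ) :=
    heq ▸ hn'
  have hK' : HasProjectiveDimensionLE (ModuleCat.of Q (LinearMap.ker f)) n := by
    rw [← projectiveDimension_le_iff]
    exact ENat.WithBot.add_le_add_one_right_iff.mp (by simpa using hK)
  exact ⟨n + 1, (hasProjectiveDimensionLE_succ_iff_ker f hf n).mpr hK'⟩

/-! ### Completions and upper complete intersection dimension -/

/-- A surjection of noetherian local rings extends to a surjection of completions. -/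
theorem exists_adicCompletion_map_surjective {R S : Type u} [CommRing R] [IsLocalRing R]
    [IsNoetherianRing R] [CommRing S] [IsLocalRing S] [IsNoetherianRing S] (φ : R →+* S)
    (hφ : Function.Surjective φ) :
    ∃ ψ : AdicCompletion (maximalIdeal R) R →+* AdicCompletion (maximalIdeal S) S,
      Function.Surjective ψ ∧ ψ.comp (algebraMap R (AdicCompletion (maximalIdeal R) R)) =
        (algebraMap S (AdicCompletion (maximalIdeal S) S)).comp φ := by
  have hmap := map_maximalIdeal_of_surjective φ hφ
  have hle : ∀ n, maximalIdeal R ^ n ≤ (maximalIdeal S ^ n).comap φ := fun n ↦ by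
    rw [← Ideal.map_le_iff_le_comap, Ideal.map_pow, hmap]
  let ψ := AdicCompletion.liftRingHom (maximalIdeal S)
    (fun n ↦ (Ideal.quotientMap (maximalIdeal S ^ n) φ (hle n)).comp
      (AdicCompletion.evalₐ (maximalIdeal R) n : AdicCompletion (maximalIdeal R) R →+* _)) (by
      intro m n hmn
      ext y
      induction y using AdicCompletion.induction_on with
      | h y =>
      rw [RingHom.comp_apply, RingHom.comp_apply, RingHom.comp_apply, RingHom.coe_coe,
        RingHom.coe_coe, AdicCompletion.evalₐ_mk, AdicCompletion.evalₐ_mk, Ideal.quotientMap_mk,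
        ← AdicCompletion.Ideal.mk_eq_mk _ hmn, Ideal.quotientMap_mk]
      rfl)
  have hψ : ψ.comp (algebraMap R (AdicCompletion (maximalIdeal R) R)) =
      (algebraMap S (AdicCompletion (maximalIdeal S) S)).comp φ := by
    refine RingHom.ext fun r ↦ ?_
    refine AdicCompletion.ext_evalₐ (I := maximalIdeal S) fun n ↦ ?_
    simp [ψ, AdicCompletion.algebraMap_apply]
  refine ⟨ψ, ?_, hψ⟩
  have hm : (maximalIdeal (AdicCompletion (maximalIdeal R) R)).map ψ =
      maximalIdeal (AdicCompletion (maximalIdeal S) S) := by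
    rw [AdicCompletion.maximalIdeal_eq_map, AdicCompletion.maximalIdeal_eq_map, Ideal.map_map, hψ,
      ← Ideal.map_map, hmap]
  have : IsHausdorff ((maximalIdeal (AdicCompletion (maximalIdeal R) R)).map ψ)
      (AdicCompletion (maximalIdeal S) S) := hm ▸ inferInstance
  refine surjective_of_mk_map_comp_surjective
    (I := maximalIdeal (AdicCompletion (maximalIdeal R) R))
    ψ fun z ↦ ?_
  obtain ⟨y, rfl⟩ := Ideal.Quotient.mk_surjective z
  obtain ⟨t, ht⟩ := (AdicCompletion.residueField_map_bijective S).2 (residue _ y)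
  obtain ⟨s, rfl⟩ := residue_surjective t
  obtain ⟨r, rfl⟩ := hφ s
  refine ⟨algebraMap R _ r, ?_⟩
  rw [IsLocalRing.ResidueField.map_residue] at ht
  rw [RingHom.comp_apply, ← RingHom.comp_apply ψ, hψ, RingHom.comp_apply, Ideal.Quotient.eq, hm]
  exact Ideal.Quotient.eq.mp ht

/-- Over a regular local ring `Q`, the module in `FiniteProjDimBaseChange` is finitely generated as
soon as both maps are surjective. -/
theorem finiteProjDimBaseChange_id {A T Q : Type u} [CommRing A] [CommRing T] [CommRing Q]
    [IsRegularLocalRing Q] {a : A →+* T} (ha : Function.Surjective a) {f : Q →+* A}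
    (hf : Function.Surjective f) : FiniteProjDimBaseChange a (RingHom.id A) f := by
  let : Algebra A T := a.toAlgebra
  let : Algebra A A := (RingHom.id A).toAlgebra
  let g : A →+* T ⊗[A] A := (Algebra.TensorProduct.includeRight : A →ₐ[A] T ⊗[A] A).toRingHom
  have hg : Function.Surjective g := Algebra.TensorProduct.includeRight_surjective _ ha
  let : Module Q (T ⊗[A] A) := Module.compHom _ (g.comp f)
  have : Module.Finite Q (T ⊗[A] A) := by
    refine Module.Finite.of_surjective
      ({ toFun := fun q ↦ g (f q), map_add' := by simp, map_smul' := ?_ } : Q →ₗ[Q] T ⊗[A] A)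
      (hg.comp hf)
    intro q r
    rw [smul_eq_mul, map_mul, map_mul]
    rfl
  obtain ⟨n, hn⟩ := IsRegularLocalRing.exists_hasProjectiveDimensionLE (Q := Q) (T ⊗[A] A)
  exact lt_top_iff_ne_top.mpr ((projectiveDimension_ne_top_iff _).mpr ⟨n, hn⟩)

/-- The Cohen factorization is `R → R̂ → Ŝ` and the quasi-deformation is `R̂ = R̂ ← Q`. The
completion `R̂` is noetherian as a quotient of `Q`. -/
theorem finiteUpperCIDim_of_surjective {R S : Type u} [CommRing R] [IsLocalRing R]
    [IsNoetherianRing R] [CommRing S] [IsLocalRing S] [IsNoetherianRing S]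
    (hR : IsLocalCompleteIntersection R) {φ : R →+* S} (hφ : Function.Surjective φ) :
    FiniteUpperCIDim φ := by
  obtain ⟨Q, _, hQ, π, hπ, hker⟩ := hR
  have hnoeth : IsNoetherianRing (AdicCompletion (maximalIdeal R) R) :=
    isNoetherianRing_of_surjective _ _ π hπ
  obtain ⟨ψ, hψ, hψφ⟩ := exists_adicCompletion_map_surjective φ hφ
  have hfield : ∀ (A : Type u) [CommRing A] [IsLocalRing A] [IsNoetherianRing A],
      IsRegularLocalRing (A ⧸ maximalIdeal A) := fun A _ _ _ ↦
    inferInstanceAs (IsRegularLocalRing (ResidueField A))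
  refine ⟨AdicCompletion (maximalIdeal R) R, inferInstance, inferInstance, hnoeth,
    algebraMap _ _, ψ, AdicCompletion (maximalIdeal R) R, inferInstance, inferInstance, hnoeth,
    Q, inferInstance, inferInstance, inferInstance, RingHom.id _, π, ?_, ?_, ?_⟩
  · refine ⟨hψφ, ⟨inferInstance, ?_, ?_⟩, inferInstance, hψ.isLocalHom, hψ⟩
    · exact RingHom.flat_algebraMap_iff.mpr inferInstance
    · rw [← AdicCompletion.maximalIdeal_eq_map]
      exact hfield _
  · refine ⟨⟨inferInstance, RingHom.Flat.id _, ?_⟩, hπ.isLocalHom, hπ, hker⟩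
    rw [Ideal.map_id]
    exact hfield _
  · exact finiteProjDimBaseChange_id hψ hπ

theorem mainTheorem4 {R : Type u} [CommRing R] [IsLocalRing R] [IsNoetherianRing R]
    (hR : IsLocalCompleteIntersection R)
    (I : Ideal R) [IsLocalRing (R ⧸ I)] (hI0 : I ≠ ⊥)
    (hI : I ⊓ maximalIdeal R ^ 2 = maximalIdeal R * I)
    (hreg : ¬ GeneratedByRegularSequence I) :
    projectiveDimension (ModuleCat.of R (R ⧸ I)) = ⊤ ∧
      FiniteUpperCIDim (Ideal.Quotient.mk I) := by
  refine ⟨?_, finiteUpperCIDim_of_surjective hR Ideal.Quotient.mk_surjective⟩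
  by_contra h
  exact hreg (generatedByRegularSequence_of_projectiveDimension_ne_top
    (le_maximalIdeal (Ideal.Quotient.nontrivial_iff.mp inferInstance)) hI.le h)
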